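/- Let $q$ be a prime power, let $n,m$ be positive integers, and let $\mathrm{Mat}_{n\times m}(\mathbb{F}_q)$ be the space of $n\times m$ matrices over the finite field $\mathbb{F}_q$; all dimensions are over $\mathbb{F}_q$. For a linear subspace $\mathcal{A}\subseteq \mathrm{Mat}_{n\times m}(\mathbb{F}_q)$ let $\mathrm{maxrk}(\mathcal{A})=\max\{\mathrm{rk}(M)\mid M\in\mathcal{A}\}$, and call $\mathcal{A}$ an \emph{optimal anticode} if $\dim(\mathcal{A})=\max\{n,m\}\cdot\mathrm{maxrk}(\mathcal{A})$. For a rank-metric code, that is, a linear subspace $\mathcal{C}\subseteq\mathrm{Mat}_{n\times m}(\mathbb{F}_q)$, and for $i=1,\ldots,\dim(\mathcal{C})$, define the generalized weights $$d_i(\mathcal{C})=\frac{1}{\max\{m,n\}}\min\{\dim(\mathcal{A})\mid \mathcal{A}\subseteq\mathrm{Mat}_{n\times m}(\mathbb{F}_q)\text{ an optimal anticode},\ \dim(\mathcal{C}\cap\mathcal{A})\ge i\}$$ and the generalized matrix weights $$\delta_i(\mathcal{C})=\min\{\dim(V)\mid V\subseteq\mathbb{F}_q^n\text{ a linear subspace},\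 \dim\{M\in\mathcal{C}\mid \mathrm{colsp}(M)\subseteq V\}\ge i\},$$ where $\mathrm{colsp}(M)\subseteq\mathbb{F}_q^n$ is the space spanned by the columns of $M$. Then for every rank-metric code $\mathcal{C}\subseteq\mathrm{Mat}_{n\times m}(\mathbb{F}_q)$: 1. if $m>n$, then $d_i(\mathcal{C})=\delta_i(\mathcal{C})$ for $i=1,\ldots,\dim(\mathcal{C})$; 2. if $m=n$, then $d_i(\mathcal{C})\le\delta_i(\mathcal{C})$ for $i=1,\ldots,\dim(\mathcal{C})$. -/

import Mathlib

namespace RankMetric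

/-- A (linear, matrix) rank-metric code: an `F`-linear subspace of the `n × m` matrices over `F`. -/
abbrev Code (F : Type*) [Field F] (n m : ℕ) : Type _ :=
  Submodule F (Matrix (Fin n) (Fin m) F)

/-- The column space of a matrix `M`: the subspace of `F ^ n` spanned by the columns of `M`. -/
def colsp {F : Type*} [Field F] {n m : ℕ} (M : Matrix (Fin n) (Fin m) F) :
    Submodule F (Fin n → F) :=
  Submodule.span F (Set.range M.col)

/-- The ranks of the elements of a code. -/
def rankSet {F : Type*} [Field F] {n m : ℕ} (C : Code F n m) : Set ℕ :=
  {r | ∃ M ∈ C, M.rank = r}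

/-- The maximum rank of an element of a code. -/
noncomputable def maxrk {F : Type*} [Field F] {n m : ℕ} (C : Code F n m) : ℕ :=
  sSup (rankSet C)

/-- An optimal anticode: a code that attains the anticode bound
`dim A ≤ max {n, m} * maxrk A`. -/
def IsOptimalAnticode {F : Type*} [Field F] {n m : ℕ} (A : Code F n m) : Prop :=
  Module.finrank F A = max n m * maxrk A

/-- The dimensions of the optimal anticodes that meet `C` in dimension at least `i`. -/
def anticodeDims {F : Type*} [Field F] {n m : ℕ} (C : Code F n m) (i : ℕ) : Set ℕ :=
  {k | ∃ A : Code F n m, IsOptimalAnticode A ∧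
    i ≤ Module.finrank F (C ⊓ A : Code F n m) ∧ Module.finrank F A = k}

/-- The `i`-th generalized weight `d_i(C)` (for `1 ≤ i ≤ dim C`), defined with optimal anticodes;
it is a quotient of integers, hence a rational number by definition. -/
noncomputable def genWeight {F : Type*} [Field F] {n m : ℕ} (C : Code F n m) (i : ℕ) : ℚ :=
  (1 / (max n m : ℕ) : ℚ) * (sInf (anticodeDims C i) : ℕ)

/-- The space of the `n × m` matrices whose column space is contained in `V`. -/
def matColsp {F : Type*} [Field F] {n : ℕ} (m : ℕ) (V : Submodule F (Fin n → F)) :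
    Code F n m where
  carrier := {M | colsp M ≤ V}
  zero_mem' := by
    simp only [Set.mem_ofPred_eq, colsp, Submodule.span_le]
    rintro _ ⟨j, rfl⟩
    exact V.zero_mem
  add_mem' := by
    simp only [Set.mem_ofPred_eq, colsp, Submodule.span_le]
    intro M N hM hN
    rintro _ ⟨j, rfl⟩
    exact V.add_mem (hM ⟨j, rfl⟩) (hN ⟨j, rfl⟩)
  smul_mem' := by
    simp only [Set.mem_ofPred_eq, colsp, Submodule.span_le]
    intro c M hM
    rintro _ ⟨j, rfl⟩
    exact V.smul_mem c (hM ⟨j, rfl⟩)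

/-- The dimensions of the subspaces `V` of `F ^ n` such that the codewords with column space
in `V` form a space of dimension at least `i`. -/
def supportDims {F : Type*} [Field F] {n m : ℕ} (C : Code F n m) (i : ℕ) : Set ℕ :=
  {k | ∃ V : Submodule F (Fin n → F),
    i ≤ Module.finrank F (C ⊓ matColsp m V : Code F n m) ∧ Module.finrank F V = k}

/-- The `i`-th generalized matrix weight `δ_i(C)` (for `1 ≤ i ≤ dim C`), defined with
column-space supports. -/
noncomputable def genMatrixWeight {F : Type*} [Field F] {n m : ℕ} (C : Code F n m) (i : ℕ) : ℕ :=
  sInf (supportDims C i)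

/-! The maximum and the minima above are taken over non-empty sets, and the maximum over a
bounded one, so they are attained. -/

theorem isGreatest_maxrk {F : Type*} [Field F] {n m : ℕ} (C : Code F n m) :
    IsGreatest (rankSet C) (maxrk C) := by
  have hb : BddAbove (rankSet C) := ⟨n, by rintro _ ⟨M, -, rfl⟩; exact M.rank_le_height⟩
  exact ⟨Nat.sSup_mem ⟨0, 0, C.zero_mem, Matrix.rank_zero⟩ hb, fun r hr => le_csSup hb hr⟩

theorem maxrk_top (F : Type*) [Field F] (n m : ℕ) : maxrk (⊤ : Code F n m) = min n m := by
  obtain ⟨⟨M, -, hM⟩, hub⟩ := isGreatest_maxrk (⊤ : Code F n m)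
  refine le_antisymm (hM ▸ le_min M.rank_le_height M.rank_le_width) ?_
  let D : Matrix (Fin n) (Fin m) F := Matrix.of fun i j => if i.val = j.val then 1 else 0
  refine le_trans ?_ (hub ⟨D, Submodule.mem_top, rfl⟩)
  rcases le_total n m with h | h
  · have h1 : D * D.transpose = 1 := by
      ext i j
      rw [Matrix.mul_apply, Finset.sum_eq_single (Fin.castLE h i)]
      · simp [D, Matrix.one_apply, Fin.ext_iff, eq_comm]
      · intro b _ hb
        have : ¬ i.val = b.val := fun e => hb (Fin.ext e.symm)
        simp [D, this]
      · simp
    have h2 := Matrix.rank_mul_le_left D D.transpose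
    rw [h1, Matrix.rank_one, Fintype.card_fin] at h2
    rwa [min_eq_left h]
  · have h1 : D.transpose * D = 1 := by
      ext i j
      rw [Matrix.mul_apply, Finset.sum_eq_single (Fin.castLE h i)]
      · simp [D, Matrix.one_apply, Fin.ext_iff]
      · intro b _ hb
        have : ¬ b.val = i.val := fun e => hb (Fin.ext e)
        simp [D, this]
      · simp
    have h2 := Matrix.rank_mul_le_right D.transpose D
    rw [h1, Matrix.rank_one, Fintype.card_fin] at h2
    rwa [min_eq_right h]

theorem isLeast_anticodeDims {F : Type*} [Field F] {n m : ℕ} (C : Code F n m) {i : ℕ}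
    (hi : i ≤ Module.finrank F C) : IsLeast (anticodeDims C i) (sInf (anticodeDims C i)) := by
  refine ⟨Nat.sInf_mem ⟨_, ⊤, ?_, by rwa [inf_top_eq], rfl⟩, fun k hk => Nat.sInf_le hk⟩
  rw [IsOptimalAnticode, maxrk_top, finrank_top, Module.finrank_matrix]
  simp [max_mul_min]

theorem isLeast_genMatrixWeight {F : Type*} [Field F] {n m : ℕ} (C : Code F n m) {i : ℕ}
    (hi : i ≤ Module.finrank F C) : IsLeast (supportDims C i) (genMatrixWeight C i) := by
  have h : matColsp m (⊤ : Submodule F (Fin n → F)) = ⊤ :=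
    eq_top_iff.2 fun M _ => show colsp M ≤ ⊤ from le_top
  exact ⟨Nat.sInf_mem ⟨_, ⊤, by rwa [h, inf_top_eq], rfl⟩, fun k hk => Nat.sInf_le hk⟩

end RankMetric

namespace RankMetric

open Module

/-! For `n ≤ m`, a Gabidulin code of dimension `m * (n - r)`, whose nonzero elements have rank above
`r`, meets any space of matrices of rank at most `r` trivially; this gives the anticode bound
(`finrank_le_card_mul_of_rank_le`). Hence each `matColsp m V` is an optimal anticode, and `d_i ≤
δ_i`. For `n < m` these are the only optimal anticodes (`IsOptimalAnticode.exists_eq_matColsp`), so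
both minima run over the same spaces. Indeed, deleting column `j` leaves at least `n` columns, so
the bound still applies and forces the space `W j` of columns that give elements of `A` supported in
column `j` to have dimension at least `r`. Choosing one vector in each `W j` yields an element of
`A`, of rank at most `r < m`; this forces all `W j` to coincide. -/

/-! ### Gabidulin codes and the anticode bound. -/

theorem exists_fieldExtension_finrank_eq (F : Type*) [Field F] [Finite F] {m : ℕ} (hm : 0 < m) :
    ∃ (L : Type) (_ : Field L) (_ : Algebra F L), Module.Finite F L ∧ finrank F L = m := by
  obtain ⟨p, hp⟩ := CharP.exists F
  have : NeZero m := ⟨hm.ne'⟩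
  have : Fact p.Prime := ⟨CharP.char_is_prime F p⟩
  exact ⟨FiniteField.Extension F p m, inferInstance, inferInstance, inferInstance,
    FiniteField.finrank_extension F p m⟩

/-- The `F`-linear endomorphism `x ↦ ∑ k, a k * x ^ (q ^ k)` of a field extension `L` of the finite
field `F` with `q` elements. -/
noncomputable def linearized (F : Type*) [Field F] [Fintype F] {L : Type*} [Field L] [Algebra F L]
    {k : ℕ} : (Fin k → L) →ₗ[F] L →ₗ[F] L :=
  ∑ t : Fin k, (LinearMap.lcomp F L (FiniteField.frobeniusAlgHom F L ^ (t : ℕ)).toLinearMap) ∘ₗ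
    (LinearMap.mul F L) ∘ₗ (LinearMap.proj t)

theorem linearized_apply {F : Type*} [Field F] [Fintype F] {L : Type*} [Field L] [Algebra F L]
    {k : ℕ} (a : Fin k → L) (x : L) :
    linearized F a x = ∑ t : Fin k, a t * x ^ (Fintype.card F ^ (t : ℕ)) := by
  simp [linearized, LinearMap.sum_apply, AlgHom.coe_pow, FiniteField.coe_frobeniusAlgHom,
    pow_iterate]

/-- The kernel of a nonzero linearized polynomial of `q`-degree less than `k` has dimension less
than `k`. -/
theorem finrank_ker_linearized_lt {F : Type*} [Field F] [Fintype F] {L : Type*} [Field L]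
    [Algebra F L] [Module.Finite F L] {k : ℕ} {a : Fin k → L} (ha : a ≠ 0) :
    finrank F (LinearMap.ker (linearized F a)) < k := by
  classical
  have : Finite L := Module.finite_of_finite F
  have hq : 1 < Fintype.card F := Fintype.one_lt_card
  obtain ⟨t₀, ht₀⟩ := Function.ne_iff.1 ha
  have hk : 0 < k := t₀.pos
  let P : Polynomial L :=
    ∑ t : Fin k, Polynomial.C (a t) * Polynomial.X ^ (Fintype.card F ^ (t : ℕ))
  have hP : P ≠ 0 := by
    intro h
    have h1 : P.coeff (Fintype.card F ^ (t₀ : ℕ)) = a t₀ := by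
      simp only [P, Polynomial.finsetSum_coeff, Polynomial.coeff_C_mul, Polynomial.coeff_X_pow]
      rw [Finset.sum_eq_single t₀]
      · simp
      · intro b _ hb
        have : ¬ Fintype.card F ^ (t₀ : ℕ) = Fintype.card F ^ (b : ℕ) := fun e =>
          hb (Fin.ext (Nat.pow_right_injective hq e).symm)
        simp [this]
      · simp
    rw [h] at h1
    exact ht₀ (by simpa using h1.symm)
  have hdeg : P.natDegree ≤ Fintype.card F ^ (k - 1) := by
    refine Polynomial.natDegree_sum_le_of_forall_le _ _ fun t _ => ?_
    refine (Polynomial.natDegree_C_mul_X_pow_le _ _).trans ?_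
    exact Nat.pow_le_pow_right hq.le (by omega)
  have hroots : ((LinearMap.ker (linearized F a) : Set L)) ⊆ P.roots.toFinset := by
    intro x hx
    have hx' : linearized F a x = 0 := hx
    rw [linearized_apply] at hx'
    simp [hP, Polynomial.IsRoot, P, Polynomial.eval_finsetSum, hx']
  -- The kernel has `q ^ dim` elements, all roots of a polynomial of degree at most `q ^ (k - 1)`.
  have hcard : Nat.card (LinearMap.ker (linearized F a)) ≤ Fintype.card F ^ (k - 1) := by
    calc Nat.card (LinearMap.ker (linearized F a))
        = (LinearMap.ker (linearized F a) : Set L).ncard := rfl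
      _ ≤ (P.roots.toFinset : Set L).ncard := Set.ncard_le_ncard hroots (Finset.finite_toSet _)
      _ = P.roots.toFinset.card := Set.ncard_coe_finset _
      _ ≤ P.roots.card := Multiset.toFinset_card_le _
      _ ≤ _ := P.card_roots'.trans hdeg
  rw [Module.natCard_eq_pow_finrank (K := F), Nat.card_eq_fintype_card,
    Nat.pow_le_pow_iff_right hq] at hcard
  omega

/-- The anticode bound for spaces of matrices with at least as many columns as rows. -/
theorem finrank_le_card_mul_of_rank_le {F : Type*} [Field F] [Finite F] {ι : Type*} [Fintype ι]
    {n r : ℕ} (hn : n ≤ Fintype.card ι) (A : Submodule F (Matrix (Fin n) ι F))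
    (hA : ∀ M ∈ A, M.rank ≤ r) : finrank F A ≤ Fintype.card ι * r := by
  classical
  have := Fintype.ofFinite F
  have htop : finrank F (Matrix (Fin n) ι F) = n * Fintype.card ι := by
    simp [Module.finrank_matrix]
  rcases le_or_gt n r with hr | hr
  · calc finrank F A ≤ n * Fintype.card ι := htop ▸ Submodule.finrank_le A
      _ ≤ _ := by rw [mul_comm]; exact Nat.mul_le_mul_left _ hr
  obtain ⟨L, _, _, hfin, hL⟩ := exists_fieldExtension_finrank_eq F (m := Fintype.card ι) (by omega)
  let b : Basis ι F L := (finBasisOfFinrankEq F L hL).reindex (Fintype.equivFin ι).symm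
  let u : Fin n → L := fun i => finBasisOfFinrankEq F L hL (Fin.castLE hn i)
  have hu : LinearIndependent F u :=
    (finBasisOfFinrankEq F L hL).linearIndependent.comp _ (Fin.castLE_injective hn)
  -- Gabidulin code: row `i` holds the coordinates of the value at `u i`. With `n - r` coefficients,
  -- kernels have dimension below `n - r`, hence ranks exceed `r`.
  let g : (Fin (n - r) → L) →ₗ[F] Matrix (Fin n) ι F :=
    { toFun := fun a => Matrix.of fun i j => b.repr (linearized F a (u i)) j
      map_add' := fun a c => by ext; simp
      map_smul' := fun c a => by ext; simp }
  have hrank : ∀ a, a ≠ 0 → r < (g a).rank := by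
    intro a ha
    have h1 := LinearMap.finrank_range_add_finrank_ker (g a).transpose.mulVecLin
    rw [finrank_fin_fun] at h1
    have h2 : (g a).rank = finrank F (LinearMap.range (g a).transpose.mulVecLin) :=
      (Matrix.rank_transpose _).symm
    -- A relation `x` among the rows says that `∑ x i • u i` is killed by the linearized map.
    have h3 : finrank F (LinearMap.ker (g a).transpose.mulVecLin) ≤
        finrank F (LinearMap.ker (linearized F a)) := by
      let φ := Fintype.linearCombination F u
      have hφ : Function.Injective φ := hu.fintypeLinearCombination_injective
      rw [(Submodule.equivMapOfInjective φ hφ _).finrank_eq]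
      refine Submodule.finrank_mono ?_
      rintro _ ⟨x, hx, rfl⟩
      have hx' : (g a).transpose.mulVec x = 0 := hx
      rw [LinearMap.mem_ker]
      apply b.repr.injective
      ext j
      have := congrFun hx' j
      simpa [φ, Fintype.linearCombination_apply, Matrix.mulVec, dotProduct, g, mul_comm] using this
    have h4 := finrank_ker_linearized_lt (F := F) ha
    omega
  have hinj : Function.Injective g := by
    rw [injective_iff_map_eq_zero]
    intro a h
    by_contra ha
    have := hrank a ha
    rw [h, Matrix.rank_zero] at this
    omega
  have hdis : Disjoint A (LinearMap.range g) := by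
    rw [Submodule.disjoint_def]
    rintro _ hM ⟨a, rfl⟩
    by_contra h
    exact absurd (hA _ hM) (not_le.2 (hrank a fun e => h (by simp [e])))
  have h1 := Submodule.finrank_add_finrank_le_of_disjoint hdis
  rw [LinearMap.finrank_range_of_inj hinj, htop, finrank_pi_fintype] at h1
  simp only [hL, Finset.sum_const, Finset.card_univ, Fintype.card_fin, smul_eq_mul] at h1
  obtain ⟨d, rfl⟩ := Nat.exists_eq_add_of_lt hr
  rw [show r + d + 1 - r = d + 1 by omega] at h1
  nlinarith

/-! ### Column-space anticodes and the inequality valid for `n ≤ m`. -/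

theorem mem_matColsp {F : Type*} [Field F] {n m : ℕ} {V : Submodule F (Fin n → F)}
    {M : Matrix (Fin n) (Fin m) F} : M ∈ matColsp m V ↔ ∀ j, M.col j ∈ V := by
  change colsp M ≤ V ↔ _
  rw [colsp, Submodule.span_le, Set.range_subset_iff]
  rfl

theorem rank_le_of_mem_matColsp {F : Type*} [Field F] {n m : ℕ} {V : Submodule F (Fin n → F)}
    {M : Matrix (Fin n) (Fin m) F} (hM : M ∈ matColsp m V) : M.rank ≤ finrank F V := by
  rw [Matrix.rank_eq_finrank_span_cols]
  exact Submodule.finrank_mono hM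

theorem finrank_matColsp {F : Type*} [Field F] {n : ℕ} (m : ℕ) (V : Submodule F (Fin n → F)) :
    finrank F (matColsp m V) = m * finrank F V := by
  let e : matColsp m V ≃ₗ[F] (Fin m → V) :=
    { toFun := fun M j => ⟨M.1.col j, mem_matColsp.1 M.2 j⟩
      map_add' := fun _ _ => rfl
      map_smul' := fun _ _ => rfl
      invFun := fun w => ⟨Matrix.of fun i j => (w j).1 i, mem_matColsp.2 fun j => (w j).2⟩
      left_inv := fun _ => rfl
      right_inv := fun _ => rfl }
  rw [e.finrank_eq, finrank_pi_fintype]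
  simp

/-- The anticode bound gives one inequality; the other needs only `maxrk ≤ dim V`, since the
dimension is `m * dim V`. -/
theorem isOptimalAnticode_matColsp {F : Type*} [Field F] [Finite F] {n m : ℕ} (hnm : n ≤ m)
    (V : Submodule F (Fin n → F)) : IsOptimalAnticode (matColsp m V) := by
  rw [IsOptimalAnticode, max_eq_right hnm]
  obtain ⟨⟨M, hM, hr⟩, hub⟩ := isGreatest_maxrk (matColsp m V)
  refine le_antisymm ?_ ?_
  · simpa using finrank_le_card_mul_of_rank_le (by simpa using hnm) (matColsp m V)
      fun N hN => hub ⟨N, hN, rfl⟩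
  · rw [finrank_matColsp, ← hr]
    exact Nat.mul_le_mul_left _ (rank_le_of_mem_matColsp hM)

theorem genWeight_le_genMatrixWeight {F : Type*} [Field F] [Finite F] {n m : ℕ} (hm : 0 < m)
    (hnm : n ≤ m) (C : Code F n m) {i : ℕ} (hi : i ≤ finrank F C) :
    genWeight C i ≤ genMatrixWeight C i := by
  obtain ⟨⟨V, hV, hk⟩, -⟩ := isLeast_genMatrixWeight C hi
  have h : sInf (anticodeDims C i) ≤ m * genMatrixWeight C i :=
    (isLeast_anticodeDims C hi).2
      ⟨_, isOptimalAnticode_matColsp hnm V, hV, by rw [finrank_matColsp, hk]⟩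
  have hm' : (0 : ℚ) < m := by exact_mod_cast hm
  rw [genWeight, max_eq_right hnm, one_div, inv_mul_le_iff₀ hm']
  exact_mod_cast h

/-! ### Classification of the optimal anticodes for `n < m`. -/

/-- The matrix with `j`-th column `w` and all other columns zero. -/
def colSingle (F : Type*) [Field F] {n m : ℕ} (j : Fin m) :
    (Fin n → F) →ₗ[F] Matrix (Fin n) (Fin m) F where
  toFun w := Matrix.of fun i => Pi.single j (w i)
  map_add' w w' := by ext; simp [Pi.single_add]
  map_smul' c w := by ext; simp [Pi.single_apply]

theorem sum_colSingle {F : Type*} [Field F] {n m : ℕ} (w : Fin m → Fin n → F) :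
    ∑ j, colSingle F j (w j) = Matrix.of fun i j => w j i := by
  ext i j
  simp [colSingle, Matrix.sum_apply, Pi.single_apply]

/-- Rank-nullity for deletion of column `j` on `A`: the image has dimension at most `(m - 1) * r` by
the anticode bound, which leaves at least `r` for the kernel, the elements of `A` supported in
column `j`. -/
theorem le_finrank_comap_colSingle {F : Type*} [Field F] [Finite F] {n m r : ℕ} (hnm : n < m)
    (A : Code F n m) (hA : ∀ M ∈ A, M.rank ≤ r) (hdim : finrank F A = m * r) (j : Fin m) :
    r ≤ finrank F (A.comap (colSingle F j)) := by
  classical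
  let ρ : Matrix (Fin n) (Fin m) F →ₗ[F] Matrix (Fin n) {k : Fin m // k ≠ j} F :=
    { toFun := fun M => M.submatrix id Subtype.val
      map_add' := fun _ _ => rfl
      map_smul' := fun _ _ => rfl }
  have hc : Fintype.card {k : Fin m // k ≠ j} = m - 1 := by
    rw [Fintype.card_subtype_compl]
    simp
  have h1 := LinearMap.finrank_range_add_finrank_ker (ρ.domRestrict A)
  have h2 : finrank F (LinearMap.range (ρ.domRestrict A)) ≤ (m - 1) * r := by
    have := finrank_le_card_mul_of_rank_le (r := r) (by rw [hc]; omega)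
      (LinearMap.range (ρ.domRestrict A)) (by
        rintro _ ⟨M, rfl⟩
        exact (Matrix.rank_submatrix_le M.1 id Subtype.val).trans (hA M.1 M.2))
    rwa [hc] at this
  have h3 : finrank F (LinearMap.ker (ρ.domRestrict A)) ≤
      finrank F (A.comap (colSingle F j)) := by
    have key : ∀ M : LinearMap.ker (ρ.domRestrict A), colSingle F j (M.1.1.col j) = M.1.1 := by
      rintro ⟨⟨M, hM⟩, hk⟩
      ext i k
      by_cases hkj : k = j
      · subst hkj; simp [colSingle]
      · have h : ρ M = 0 := hk
        have : M i k = 0 := congrFun (congrFun h i) ⟨k, hkj⟩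
        simp [colSingle, hkj, this]
    let ψ : LinearMap.ker (ρ.domRestrict A) →ₗ[F] A.comap (colSingle F j) :=
      { toFun := fun M => ⟨M.1.1.col j, by
          rw [Submodule.mem_comap, key]; exact M.1.2⟩
        map_add' := fun _ _ => rfl
        map_smul' := fun _ _ => rfl }
    refine LinearMap.finrank_le_finrank_of_injective (f := ψ) fun M N h => ?_
    have h' : M.1.1.col j = N.1.1.col j := congrArg Subtype.val h
    exact Subtype.ext (Subtype.ext (by rw [← key M, ← key N, h']))
  obtain ⟨m, rfl⟩ : ∃ k, m = k + 1 := ⟨m - 1, by omega⟩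
  rw [Nat.add_sub_cancel] at h2
  rw [hdim] at h1
  nlinarith

theorem linearIndepOn_update_insert {F E ι : Type*} [Field F] [AddCommGroup E] [Module F E]
    [DecidableEq ι] {w : ι → E} {s : Finset ι} (hw : LinearIndepOn F w (s : Set ι)) {b : ι}
    (hb : b ∉ s) {y : E} (hy : y ∉ Submodule.span F (w '' s)) :
    LinearIndepOn F (Function.update w b y) (insert b s : Finset ι) := by
  have heq : Set.EqOn w (Function.update w b y) s := fun k hk =>
    (Function.update_of_ne (ne_of_mem_of_not_mem hk hb) _ _).symm
  rw [Finset.coe_insert, linearIndepOn_insert (by simpa using hb), Function.update_self,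
    ← heq.image_eq]
  exact ⟨hw.congr heq, hy⟩

theorem finrank_span_image_of_linearIndepOn {F E ι : Type*} [Field F] [AddCommGroup E]
    [Module F E] {w : ι → E} {s : Finset ι} (hw : LinearIndepOn F w (s : Set ι)) :
    finrank F (Submodule.span F (w '' s)) = s.card := by
  rw [Set.image_eq_range]
  simpa using finrank_span_eq_card (R := F) hw

/-- If a vector is to be chosen in each of the subspaces `W j`, all of dimension at least `r`, then
the choice can be made linearly independent on a set of `r` indices, with one vector prescribed. -/
theorem exists_linearIndepOn_insert {F E ι : Type*} [Field F] [AddCommGroup E] [Module F E]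
    [Module.Finite F E] [DecidableEq ι] (W : ι → Submodule F E) {r : ℕ}
    (hW : ∀ j, r ≤ finrank F (W j)) {a : ι} {x : E} (hx : x ∈ W a) (hx0 : x ≠ 0) (s : Finset ι)
    (ha : a ∉ s) (hs : s.card < r) :
    ∃ w : ι → E, (∀ j, w j ∈ W j) ∧ w a = x ∧
      LinearIndepOn F w ((insert a s : Finset ι) : Set ι) := by
  induction s using Finset.induction_on with
  | empty =>
    refine ⟨Function.update 0 a x, fun j => ?_, by simp, ?_⟩
    · by_cases h : j = a
      · subst h; simpa using hx
      · simp [h]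
    · simpa using hx0
  | insert b s hb ih =>
    rw [Finset.mem_insert, not_or] at ha
    rw [Finset.card_insert_of_notMem hb] at hs
    obtain ⟨w, hw, hwa, hind⟩ := ih ha.2 (by omega)
    -- The span has dimension `s.card + 1 < r`, too small to contain `W b`.
    obtain ⟨y, hy, hyn⟩ : ∃ y ∈ W b, y ∉ Submodule.span F (w '' (insert a s : Finset ι)) := by
      by_contra! h
      have h1 := Submodule.finrank_mono (R := F) (show W b ≤ _ from h)
      rw [finrank_span_image_of_linearIndepOn hind, Finset.card_insert_of_notMem ha.2] at h1
      have := hW b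
      omega
    refine ⟨Function.update w b y, fun j => ?_, by rwa [Function.update_of_ne ha.1], ?_⟩
    · by_cases h : j = b
      · subst h; simpa using hy
      · simpa [h] using hw j
    · rw [Finset.insert_comm]
      exact linearIndepOn_update_insert hind (by simp [hb, Ne.symm ha.1]) hyn

/-- If every choice of a vector in each of the subspaces `W j`, all of dimension at least `r`, spans
a space of dimension at most `r`, and there are more than `r` subspaces, then they all agree. -/
theorem le_of_forall_finrank_span_le {F E ι : Type*} [Field F] [AddCommGroup E] [Module F E]
    [Module.Finite F E] [Fintype ι] (W : ι → Submodule F E) {r : ℕ} (hr : r < Fintype.card ι)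
    (hW : ∀ j, r ≤ finrank F (W j))
    (hspan : ∀ w : ι → E, (∀ j, w j ∈ W j) → finrank F (Submodule.span F (Set.range w)) ≤ r)
    (a b : ι) : W a ≤ W b := by
  classical
  intro x hx
  by_contra hxb
  have hab : a ≠ b := fun e => hxb (e ▸ hx)
  have hx0 : x ≠ 0 := fun e => hxb (e ▸ (W b).zero_mem)
  have hcard : ∀ (w : ι → E) (s : Finset ι), (∀ j, w j ∈ W j) → LinearIndepOn F w (s : Set ι) →
      s.card ≤ r := fun w s hw hs => by
    rw [← finrank_span_image_of_linearIndepOn hs]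
    exact (Submodule.finrank_mono (Submodule.span_mono (Set.image_subset_range _ _))).trans
      (hspan w hw)
  have hr0 : 0 < r := by
    have := hcard (Function.update 0 a x) {a} (fun j => by
      by_cases h : j = a
      · subst h; simpa using hx
      · simp [h]) (by simpa using hx0)
    rwa [Finset.card_singleton] at this
  -- Together with `a` and `b`, these `r - 1` indices make `r + 1`, which is possible because `r <
  -- Fintype.card ι`.
  obtain ⟨s, hsub, hs⟩ := Finset.exists_subset_card_eq
    (s := ((Finset.univ : Finset ι).erase a).erase b) (n := r - 1) (by
      rw [Finset.card_erase_of_mem (by simp [Ne.symm hab]),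
        Finset.card_erase_of_mem (Finset.mem_univ _), Finset.card_univ]
      omega)
  have ha : a ∉ s := fun h => by simpa using hsub h
  have hb : b ∉ s := fun h => by simpa using hsub h
  obtain ⟨w, hw, hwa, hind⟩ := exists_linearIndepOn_insert W hW hx hx0 s ha (by omega)
  have hTc := finrank_span_image_of_linearIndepOn hind
  rw [Finset.card_insert_of_notMem ha, hs, Nat.sub_add_cancel hr0] at hTc
  have hxT : x ∈ Submodule.span F (w '' (insert a s : Finset ι)) :=
    Submodule.subset_span ⟨a, by simp, hwa⟩
  -- The span has dimension exactly `r`, so containing `W b` would mean equality and put `x` in `W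
  -- b`. The resulting `y` completes `r + 1` independent vectors.
  obtain ⟨y, hy, hyn⟩ : ∃ y ∈ W b, y ∉ Submodule.span F (w '' (insert a s : Finset ι)) := by
    by_contra! h
    have h1 := Submodule.eq_of_le_of_finrank_le (show W b ≤ _ from h) (hTc ▸ hW b)
    exact hxb (h1 ▸ hxT)
  have hb' : b ∉ insert a s := by simp [hb, Ne.symm hab]
  have := hcard (Function.update w b y) (insert b (insert a s)) (fun j => by
    by_cases h : j = b
    · subst h; simpa using hy
    · simpa [h] using hw j) (linearIndepOn_update_insert hind hb' hyn)
  rw [Finset.card_insert_of_notMem hb', Finset.card_insert_of_notMem ha] at this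
  omega

/-- With more columns than rows, every optimal anticode consists of all matrices with column space
in a given subspace. -/
theorem IsOptimalAnticode.exists_eq_matColsp {F : Type*} [Field F] [Finite F] {n m : ℕ}
    (hnm : n < m) {A : Code F n m} (hA : IsOptimalAnticode A) :
    ∃ V : Submodule F (Fin n → F), A = matColsp m V := by
  rw [IsOptimalAnticode, max_eq_right hnm.le] at hA
  obtain ⟨⟨M₀, -, hM₀⟩, hub⟩ := isGreatest_maxrk A
  have hrk : ∀ M ∈ A, M.rank ≤ maxrk A := fun M hM => hub ⟨M, hM, rfl⟩
  have hrn : maxrk A ≤ n := hM₀ ▸ M₀.rank_le_height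
  have hW := le_finrank_comap_colSingle hnm A hrk hA
  have hle := le_of_forall_finrank_span_le (fun j => A.comap (colSingle F j))
    (by simpa using hrn.trans_lt hnm) hW fun w hw => by
      have := hrk (∑ j, colSingle F j (w j)) (A.sum_mem fun j _ => hw j)
      rw [sum_colSingle, Matrix.rank_eq_finrank_span_cols] at this
      exact this
  let j₀ : Fin m := ⟨0, by omega⟩
  -- `matColsp` of the common column space lies in `A`, and its dimension is at least `m * maxrk A =
  -- dim A`.
  refine ⟨A.comap (colSingle F j₀), (Submodule.eq_of_le_of_finrank_le (fun M hM => ?_) ?_).symm⟩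
  · have h : M = ∑ j, colSingle F j (M.col j) := by rw [sum_colSingle]; rfl
    rw [h]
    exact A.sum_mem fun j _ => hle j₀ j (mem_matColsp.1 hM j)
  · rw [finrank_matColsp, hA]
    exact Nat.mul_le_mul_left _ (hW j₀)

theorem genMatrixWeight_le_genWeight {F : Type*} [Field F] [Finite F] {n m : ℕ} (hnm : n < m)
    (C : Code F n m) {i : ℕ} (hi : i ≤ finrank F C) :
    genMatrixWeight C i ≤ genWeight C i := by
  obtain ⟨⟨A, hA, hCA, hk⟩, -⟩ := isLeast_anticodeDims C hi
  obtain ⟨V, rfl⟩ := hA.exists_eq_matColsp hnm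
  have h : genMatrixWeight C i ≤ finrank F V := (isLeast_genMatrixWeight C hi).2 ⟨V, hCA, rfl⟩
  have hm' : (m : ℚ) ≠ 0 := by exact_mod_cast (show m ≠ 0 by omega)
  rw [genWeight, max_eq_right hnm.le, ← hk, finrank_matColsp, Nat.cast_mul, ← mul_assoc,
    one_div_mul_cancel hm', one_mul]
  exact_mod_cast h

end RankMetric

theorem mainTheorem3 {F : Type*} [Field F] [Finite F] {n m : ℕ} (hn : 0 < n) (hm : 0 < m)
    (C : RankMetric.Code F n m) :
    (n < m → ∀ i : ℕ, 1 ≤ i → i ≤ Module.finrank F C →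
      RankMetric.genWeight C i = (RankMetric.genMatrixWeight C i : ℚ)) ∧
    (m = n → ∀ i : ℕ, 1 ≤ i → i ≤ Module.finrank F C →
      RankMetric.genWeight C i ≤ (RankMetric.genMatrixWeight C i : ℚ)) := by
  refine ⟨fun hnm i _ hi => ?_, fun hmn i _ hi => ?_⟩
  · exact le_antisymm (RankMetric.genWeight_le_genMatrixWeight hm hnm.le C hi)
      (RankMetric.genMatrixWeight_le_genWeight hnm C hi)
  · exact RankMetric.genWeight_le_genMatrixWeight hm hmn.ge C hi
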